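/- Let $B=\{x\in\mathbb{R}^2:|x|\le 1\}$ be the closed unit disc, where $|\cdot|$ is the Euclidean norm. Let $0<h<2$, $D_1:=B$, $D_2:=B+(0,h)$ and $D:=D_1\cap D_2$. For $x\in D$ put $d_1^*(x):=1-|x|$ and $d_2^*(x):=1-|x-(0,h)|$; then $d_i^*(x)$ is the distance from $x$ to $\partial D_i$, $i=1,2$. For an integer $n\ge 1$ and $t\ge 0$ let $\rho_n^*(t):=n^{-2}+n^{-1}\sqrt{t}$, and let $$\lambda_n(D,x):=\Big(\sum_{k=1}^{N}p_k(x)^2\Big)^{-1},\qquad x\in D,$$ be the Christoffel function of $D$, where $\{p_k\}_{k=1}^{N}$ is any orthonormal basis, with respect to $\langle f,g\rangle=\int_D f(y)g(y)\,dy$, of the space of real polynomials in two variables of total degree at most $n$ (the sum does not depend on the choice of the basis). Then there is a constant $c(h)>0$, depending only on $h$, such that for every integer $n\ge 1$ and every $x\in D$ $$\lambda_n(D,x)\ge c(h)\,\rho_n^*(d_1^*(x))\,\rho_n^*(d_2^*(x)).$$ -/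

import Mathlib

namespace Grain

/-- The Euclidean plane. -/
abbrev Plane := EuclideanSpace ℝ (Fin 2)

/-- The space of real polynomials in two variables of total degree at most `n`. -/
noncomputable abbrev Poly (n : ℕ) : Submodule ℝ (MvPolynomial (Fin 2) ℝ) :=
  MvPolynomial.restrictTotalDegree (Fin 2) ℝ n

/-- The value of a polynomial at a point of the plane. -/
noncomputable def value (f : MvPolynomial (Fin 2) ℝ) (x : Plane) : ℝ :=
  MvPolynomial.eval (fun i => x i) f

/-- The inner product `∫_D f g` (Lebesgue measure, weight `1`). -/
noncomputable def l2Inner (D : Set Plane) (f g : MvPolynomial (Fin 2) ℝ) : ℝ :=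
  ∫ y in D, value f y * value g y

/-- A basis of the space of polynomials of degree at most `n` that is orthonormal
with respect to `∫_D f g`. -/
def IsOrthonormalBasis (D : Set Plane) {n : ℕ}
    (p : Module.Basis (Fin (Module.finrank ℝ (Poly n))) ℝ (Poly n)) : Prop :=
  ∀ i j, l2Inner D (p i) (p j) = if i = j then 1 else 0

open Classical in
/-- The Christoffel function `λ_n(D, x) = (∑ₖ pₖ(x)²)⁻¹`, for an orthonormal basis `pₖ` of the
polynomials of degree at most `n`. For compact `D` with non-empty interior such a basis exists
(`exists_isOrthonormalBasis`) and the value does not depend on it (`christoffel_eq`). -/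
noncomputable def christoffel (n : ℕ) (D : Set Plane) (x : Plane) : ℝ :=
  if h : ∃ p : Module.Basis (Fin (Module.finrank ℝ (Poly n))) ℝ (Poly n), IsOrthonormalBasis D p
  then (∑ k, value (h.choose k) x ^ 2)⁻¹
  else 0

/-- `ρ_n^*(t) = n⁻² + n⁻¹ √t`, used for `n ≥ 1` and `t ≥ 0`. -/
noncomputable def rhoStar (n : ℕ) (t : ℝ) : ℝ :=
  ((n : ℝ) ^ 2)⁻¹ + (n : ℝ)⁻¹ * Real.sqrt t

/-- The point `(0, h)`. -/
noncomputable def shift (h : ℝ) : Plane := !₂[0, h]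

/-- The closed unit disc `D₁ = B`. -/
def disc₁ : Set Plane := Metric.closedBall 0 1

/-- The translated disc `D₂ = B + (0, h)`. -/
noncomputable def disc₂ (h : ℝ) : Set Plane := (fun y => y + shift h) '' disc₁

/-- The grain `D = D₁ ∩ D₂`. -/
noncomputable def grain (h : ℝ) : Set Plane := disc₁ ∩ disc₂ h

/-- `d₁^*(x) = 1 - |x|`. -/
noncomputable def dStar₁ (x : Plane) : ℝ := 1 - ‖x‖

/-- `d₂^*(x) = 1 - |x - (0, h)|`. -/
noncomputable def dStar₂ (h : ℝ) (x : Plane) : ℝ := 1 - ‖x - shift h‖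

/-! The Christoffel function is well defined. -/

theorem continuous_value (f : MvPolynomial (Fin 2) ℝ) : Continuous (value f) := by
  unfold value
  exact (MvPolynomial.continuous_eval f).comp (by fun_prop)

theorem integrableOn_value {D : Set Plane} (hD : IsCompact D) (f g : MvPolynomial (Fin 2) ℝ) :
    MeasureTheory.IntegrableOn (fun y => value f y * value g y) D :=
  ((continuous_value f).mul (continuous_value g)).continuousOn.integrableOn_compact hD

theorem l2Inner_comm (D : Set Plane) (f g : MvPolynomial (Fin 2) ℝ) :
    l2Inner D f g = l2Inner D g f := by
  unfold l2Inner
  simp only [mul_comm]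

theorem l2Inner_add_left {D : Set Plane} (hD : IsCompact D) (f g k : MvPolynomial (Fin 2) ℝ) :
    l2Inner D (f + g) k = l2Inner D f k + l2Inner D g k := by
  unfold l2Inner
  rw [← MeasureTheory.integral_add (integrableOn_value hD f k) (integrableOn_value hD g k)]
  simp [value, add_mul]

theorem l2Inner_smul_left (D : Set Plane) (r : ℝ) (f k : MvPolynomial (Fin 2) ℝ) :
    l2Inner D (r • f) k = r * l2Inner D f k := by
  unfold l2Inner
  rw [← MeasureTheory.integral_const_mul]
  simp [value, MvPolynomial.smul_eval, mul_assoc]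

theorem l2Inner_self_nonneg (D : Set Plane) (f : MvPolynomial (Fin 2) ℝ) : 0 ≤ l2Inner D f f :=
  MeasureTheory.integral_nonneg fun y => mul_self_nonneg (value f y)

theorem eq_zero_of_l2Inner_self {D : Set Plane} (hD : IsCompact D) (hi : (interior D).Nonempty)
    (f : MvPolynomial (Fin 2) ℝ) (hf : l2Inner D f f = 0) : f = 0 := by
  have hae : (fun y => value f y * value f y) =ᵐ[MeasureTheory.volume.restrict D] 0 :=
    (MeasureTheory.integral_eq_zero_iff_of_nonneg (fun y => mul_self_nonneg (value f y))
      (integrableOn_value hD f f)).1 hf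
  have hae' : (fun y => value f y * value f y)
      =ᵐ[MeasureTheory.volume.restrict (interior D)] fun _ => 0 :=
    MeasureTheory.ae_restrict_of_ae_restrict_of_subset interior_subset hae
  have hz : Set.EqOn (fun y => value f y * value f y) (fun _ => 0) (interior D) :=
    MeasureTheory.Measure.eqOn_open_of_ae_eq hae' isOpen_interior
      ((continuous_value f).mul (continuous_value f)).continuousOn continuousOn_const
  have hopen : IsOpen ((fun v : Fin 2 → ℝ => (WithLp.toLp 2 v : Plane)) ⁻¹' interior D) :=
    isOpen_interior.preimage (PiLp.continuous_toLp 2 _)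
  obtain ⟨a, ha⟩ := hi
  obtain ⟨ε, hε, hball⟩ := Metric.isOpen_iff.1 hopen (WithLp.ofLp a) (by simpa using ha)
  refine MvPolynomial.funext_set (fun i => Metric.ball (a i) ε) ?_ ?_
  · intro i
    rw [Real.ball_eq_Ioo]
    exact Set.Ioo_infinite (by linarith)
  · intro v hv
    have hv' : v ∈ Metric.ball (WithLp.ofLp a) ε := by
      rw [ball_pi _ hε]
      exact hv
    have := hz (hball hv')
    simpa [value] using this

theorem exists_isOrthonormalBasis (n : ℕ) {D : Set Plane} (hD : IsCompact D)
    (hi : (interior D).Nonempty) :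
    ∃ p : Module.Basis (Fin (Module.finrank ℝ (Poly n))) ℝ (Poly n), IsOrthonormalBasis D p := by
  let core : InnerProductSpace.Core ℝ (Poly n) :=
    { inner := fun f g => l2Inner D f g
      conj_inner_symm := fun f g => by
        simpa using l2Inner_comm D g f
      re_inner_nonneg := fun f => by
        simpa using l2Inner_self_nonneg D f
      add_left := fun f g k => l2Inner_add_left hD f g k
      smul_left := fun f g r => by
        simpa using l2Inner_smul_left D r f g
      definite := fun f hf => Subtype.ext (eq_zero_of_l2Inner_self hD hi f hf) }
  let _ : NormedAddCommGroup (Poly n) := core.toNormedAddCommGroup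
  let _ : InnerProductSpace ℝ (Poly n) := InnerProductSpace.ofCore core.toCore
  refine ⟨(stdOrthonormalBasis ℝ (Poly n)).toBasis, fun i j => ?_⟩
  have := orthonormal_iff_ite.1 (stdOrthonormalBasis ℝ (Poly n)).orthonormal i j
  rw [OrthonormalBasis.coe_toBasis]
  exact this

/-- The extremal property, for any orthonormal basis. -/
theorem isLeast_of_isOrthonormalBasis {n : ℕ} {D : Set Plane} (hD : IsCompact D)
    {p : Module.Basis (Fin (Module.finrank ℝ (Poly n))) ℝ (Poly n)}
    (hp : IsOrthonormalBasis D p) (x : Plane) :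
    IsLeast {r : ℝ | ∃ f ∈ Poly n, value f x = 1 ∧ r = ∫ y in D, value f y ^ 2}
      (∑ k, value (p k) x ^ 2)⁻¹ := by
  let B : Poly n →ₗ[ℝ] Poly n →ₗ[ℝ] ℝ := LinearMap.mk₂ ℝ (fun f g => l2Inner D f g)
    (fun f g k => l2Inner_add_left hD f g k) (fun r f k => l2Inner_smul_left D r f k)
    (fun f g k => by
      rw [l2Inner_comm, l2Inner_comm D f g, l2Inner_comm D f k]
      exact l2Inner_add_left hD g k f)
    (fun r f k => by
      rw [l2Inner_comm, l2Inner_comm D f k]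
      exact l2Inner_smul_left D r k f)
  let ev : Poly n →ₗ[ℝ] ℝ :=
    { toFun := fun f => value f x
      map_add' := fun f g => by simp [value]
      map_smul' := fun r f => by simp [value, MvPolynomial.smul_eval] }
  have hB : ∀ a : Fin (Module.finrank ℝ (Poly n)) → ℝ,
      ∫ y in D, value ((∑ k, a k • p k : Poly n) : MvPolynomial (Fin 2) ℝ) y ^ 2
        = ∑ k, a k ^ 2 := by
    intro a
    have h1 : B (∑ k, a k • p k) (∑ k, a k • p k) = ∑ k, a k ^ 2 := by
      have hpp : ∀ i j, B (p i) (p j) = if i = j then 1 else 0 := hp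
      simp [map_sum, LinearMap.sum_apply, hpp, sq]
    rw [← h1]
    simp only [sq]
    rfl
  have hev : ∀ a : Fin (Module.finrank ℝ (Poly n)) → ℝ,
      value ((∑ k, a k • p k : Poly n) : MvPolynomial (Fin 2) ℝ) x
        = ∑ k, a k * value (p k) x := by
    intro a
    have h1 : ev (∑ k, a k • p k) = ∑ k, a k * ev (p k) := by simp [map_sum]
    exact h1
  have hK : 0 < ∑ k, value (p k) x ^ 2 := by
    have h1 : (1 : MvPolynomial (Fin 2) ℝ) ∈ Poly n := by
      rw [MvPolynomial.mem_restrictTotalDegree]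
      simp
    have h2 := hev (fun k => p.repr ⟨1, h1⟩ k)
    rw [p.sum_repr] at h2
    refine lt_of_le_of_ne (Finset.sum_nonneg fun k _ => sq_nonneg _) fun h0 => ?_
    have h3 := (Finset.sum_eq_zero_iff_of_nonneg fun k _ => sq_nonneg (value (p k) x)).1 h0.symm
    have h4 : ∀ k, value (p k) x = 0 := fun k => by simpa using h3 k (Finset.mem_univ k)
    simp only [h4, mul_zero, Finset.sum_const_zero] at h2
    simp [value] at h2
  constructor
  · refine ⟨(∑ k, ((∑ j, value (p j) x ^ 2)⁻¹ * value (p k) x) • p k : Poly n),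
      Subtype.property _, ?_, ?_⟩
    · rw [hev]
      simp only [mul_assoc, ← sq]
      rw [← Finset.mul_sum]
      exact inv_mul_cancel₀ hK.ne'
    · rw [hB]
      simp only [mul_pow]
      rw [← Finset.mul_sum]
      field_simp
  · rintro r ⟨f, hf, hfx, rfl⟩
    have h1 := hB (fun k => p.repr ⟨f, hf⟩ k)
    have h2 := hev (fun k => p.repr ⟨f, hf⟩ k)
    rw [p.sum_repr] at h1 h2
    simp only at h1 h2
    rw [h1]
    rw [hfx] at h2
    have h3 := Finset.sum_mul_sq_le_sq_mul_sq Finset.univ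
      (fun k => p.repr ⟨f, hf⟩ k) (fun k => value (p k) x)
    rw [← h2] at h3
    rw [inv_eq_one_div, div_le_iff₀ hK]
    simpa using h3

/-- The value of the Christoffel function does not depend on the orthonormal basis. -/
theorem christoffel_eq {n : ℕ} {D : Set Plane} (hD : IsCompact D)
    {p : Module.Basis (Fin (Module.finrank ℝ (Poly n))) ℝ (Poly n)}
    (hp : IsOrthonormalBasis D p) (x : Plane) :
    christoffel n D x = (∑ k, value (p k) x ^ 2)⁻¹ := by
  have h : ∃ p : Module.Basis (Fin (Module.finrank ℝ (Poly n))) ℝ (Poly n),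
    IsOrthonormalBasis D p := ⟨p, hp⟩
  rw [christoffel, dif_pos h]
  exact (isLeast_of_isOrthonormalBasis hD h.choose_spec x).unique
    (isLeast_of_isOrthonormalBasis hD hp x)

end Grain

namespace Grain

open Polynomial in
/-- `z ^ N * p ((z + z⁻¹) / 2)` is a polynomial in `z`. -/
theorem exists_circle_lift (p : ℝ[X]) {N : ℕ} (hp : p.natDegree ≤ N) :
    ∃ G : ℂ[X], G.natDegree ≤ 2 * N ∧
      ∀ θ : ℝ, ‖G.eval (circleMap 0 1 θ)‖ ^ 2 = p.eval (Real.cos θ) ^ 2 := by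
  refine ⟨∑ k ∈ Finset.range (N + 1),
    C (p.coeff k : ℂ) * ((X ^ 2 + 1) * C (1 / 2)) ^ k * X ^ (N - k), ?_, fun θ => ?_⟩
  · refine natDegree_sum_le_of_forall_le _ _ fun k hk => ?_
    have hk' : k ≤ N := Nat.lt_succ_iff.1 (Finset.mem_range.1 hk)
    have h1 : (((X : ℂ[X]) ^ 2 + 1) * C (1 / 2)).natDegree ≤ 2 := by compute_degree
    have h2 : ((((X : ℂ[X]) ^ 2 + 1) * C (1 / 2)) ^ k).natDegree ≤ k * 2 := natDegree_pow_le_of_le k h1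
    refine (natDegree_mul_le_of_le (natDegree_C_mul_le _ _ |>.trans h2)
      (natDegree_X_pow_le (N - k))).trans ?_
    omega
  · set z : ℂ := circleMap 0 1 θ with hz
    have hz' : z = Complex.exp (θ * Complex.I) := by simp [hz, circleMap]
    have hcos : (z ^ 2 + 1) * (1 / 2) = z * (Real.cos θ : ℂ) := by
      have h1 : Complex.exp (θ * Complex.I) * Complex.exp (-θ * Complex.I) = 1 := by
        rw [← Complex.exp_add]; simp
      rw [hz', Complex.ofReal_cos, Complex.cos]
      linear_combination (-1 / 2) * h1
    have hsum : eval z (∑ k ∈ Finset.range (N + 1),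
        C (p.coeff k : ℂ) * ((X ^ 2 + 1) * C (1 / 2)) ^ k * X ^ (N - k))
        = z ^ N * ((p.eval (Real.cos θ) : ℝ) : ℂ) := by
      rw [eval_eq_sum_range' (Nat.lt_succ_iff.2 hp), eval_finsetSum, Complex.ofReal_sum,
        Finset.mul_sum]
      refine Finset.sum_congr rfl fun k hk => ?_
      have hk' : k ≤ N := Nat.lt_succ_iff.1 (Finset.mem_range.1 hk)
      simp only [eval_mul, eval_C, eval_pow, eval_add, eval_X, eval_one]
      rw [hcos, ← Nat.add_sub_of_le hk', pow_add]
      simp only [Nat.add_sub_cancel_left]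
      push_cast
      ring
    have hn : ‖z‖ = 1 := by simp [hz]
    rw [hsum, norm_mul, norm_pow, hn]
    simp

open Polynomial in
theorem integral_norm_sq_circle (G : ℂ[X]) {M : ℕ} (hG : G.natDegree ≤ M) :
    ∫ θ in (0 : ℝ)..2 * Real.pi, ‖G.eval (circleMap 0 1 θ)‖ ^ 2
      = 2 * Real.pi * ∑ i ∈ Finset.range (M + 1), ‖G.coeff i‖ ^ 2 := by
  have h := G.sum_sq_norm_coeff_eq_circleAverage
  have h1 : ∑ i ∈ Finset.range (M + 1), ‖G.coeff i‖ ^ 2 = ∑ i ∈ G.support, ‖G.coeff i‖ ^ 2 := by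
    refine (Finset.sum_subset (fun i hi => ?_) fun i _ hi => ?_).symm
    · exact Finset.mem_range.2 (Nat.lt_succ_iff.2 ((le_natDegree_of_mem_supp i hi).trans hG))
    · simp [notMem_support_iff.1 hi]
  rw [h1, h, Real.circleAverage_def, smul_eq_mul]
  field_simp

open Polynomial in
theorem norm_eval_sq_le_integral (G : ℂ[X]) {M : ℕ} (hG : G.natDegree ≤ M) (φ : ℝ) :
    2 * Real.pi * ‖G.eval (circleMap 0 1 φ)‖ ^ 2
      ≤ (M + 1) * ∫ θ in (0 : ℝ)..2 * Real.pi, ‖G.eval (circleMap 0 1 θ)‖ ^ 2 := by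
  rw [integral_norm_sq_circle G hG]
  have h1 : ‖G.eval (circleMap 0 1 φ)‖ ≤ ∑ i ∈ Finset.range (M + 1), ‖G.coeff i‖ := by
    rw [eval_eq_sum_range' (Nat.lt_succ_iff.2 hG)]
    refine (norm_sum_le _ _).trans (le_of_eq (Finset.sum_congr rfl fun i _ => ?_))
    simp
  have h2 : ‖G.eval (circleMap 0 1 φ)‖ ^ 2 ≤ (M + 1) * ∑ i ∈ Finset.range (M + 1), ‖G.coeff i‖ ^ 2 := by
    refine (pow_le_pow_left₀ (norm_nonneg _) h1 2).trans ?_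
    simpa using sq_sum_le_card_mul_sum_sq (s := Finset.range (M + 1)) (f := fun i => ‖G.coeff i‖)
  have := Real.pi_pos
  nlinarith [mul_le_mul_of_nonneg_left h2 (by positivity : 0 ≤ 2 * Real.pi)]

open Polynomial in
theorem norm_eval_X_pow_sub_one (m : ℕ) (θ : ℝ) :
    ‖((X : ℂ[X]) ^ (2 * m) - 1).eval (circleMap 0 1 θ)‖ ^ 2 = 4 * Real.sin (m * θ) ^ 2 := by
  have h : ((X : ℂ[X]) ^ (2 * m) - 1).eval (circleMap 0 1 θ)
      = Complex.exp (Complex.I * ((2 * m * θ : ℝ) : ℂ)) - 1 := by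
    simp only [eval_sub, eval_pow, eval_X, eval_one, circleMap]
    rw [zero_add, Complex.ofReal_one, one_mul, ← Complex.exp_nat_mul]
    push_cast
    ring_nf
  rw [h, Complex.norm_exp_I_mul_ofReal_sub_one, Real.norm_eq_abs, sq_abs]
  ring_nf

theorem abs_sin_nat_mul_le (m : ℕ) (θ : ℝ) : |Real.sin (m * θ)| ≤ m * |Real.sin θ| := by
  induction m with
  | zero => simp
  | succ k ih =>
    have h : Real.sin ((k + 1 : ℕ) * θ)
        = Real.sin (k * θ) * Real.cos θ + Real.cos (k * θ) * Real.sin θ := by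
      rw [← Real.sin_add]; push_cast; ring_nf
    rw [h]
    refine (abs_add_le _ _).trans ?_
    rw [abs_mul, abs_mul]
    push_cast
    nlinarith [Real.abs_cos_le_one θ, Real.abs_cos_le_one (k * θ), abs_nonneg (Real.sin θ),
      abs_nonneg (Real.sin (k * θ))]

theorem sin_nat_mul_sq_le (m : ℕ) (θ : ℝ) : Real.sin (m * θ) ^ 2 ≤ m * |Real.sin θ| := by
  rw [← sq_abs]
  nlinarith [abs_sin_nat_mul_le m θ, Real.abs_sin_le_one (m * θ), abs_nonneg (Real.sin (m * θ))]

theorem integral_comp_cos_mul_abs_sin {f : ℝ → ℝ} (hf : Continuous f) :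
    ∫ θ in (0 : ℝ)..2 * Real.pi, f (Real.cos θ) * |Real.sin θ| = 2 * ∫ x in (-1 : ℝ)..1, f x := by
  have hpi := Real.pi_pos
  have hc : Continuous fun θ => f (Real.cos θ) * |Real.sin θ| := by fun_prop
  rw [← intervalIntegral.integral_add_adjacent_intervals (b := Real.pi)
    (hc.intervalIntegrable _ _) (hc.intervalIntegrable _ _)]
  have key : ∀ a b : ℝ, ∫ θ in a..b, (f ∘ Real.cos) θ * (-Real.sin θ)
      = ∫ x in Real.cos a..Real.cos b, f x := fun a b =>
    intervalIntegral.integral_comp_mul_deriv (fun x _ => Real.hasDerivAt_cos x)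
      (by fun_prop) hf
  have h1 : ∫ θ in (0 : ℝ)..Real.pi, f (Real.cos θ) * |Real.sin θ| = ∫ x in (-1 : ℝ)..1, f x := by
    have := key Real.pi 0
    rw [Real.cos_pi, Real.cos_zero, intervalIntegral.integral_symm,
      ← intervalIntegral.integral_neg] at this
    rw [← this]
    refine intervalIntegral.integral_congr fun θ hθ => ?_
    rw [Set.uIcc_of_le hpi.le] at hθ
    simp [abs_of_nonneg (Real.sin_nonneg_of_mem_Icc hθ)]
  have h2 : ∫ θ in Real.pi..2 * Real.pi, f (Real.cos θ) * |Real.sin θ|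
      = ∫ x in (-1 : ℝ)..1, f x := by
    have := key Real.pi (2 * Real.pi)
    rw [Real.cos_pi, Real.cos_two_pi] at this
    rw [← this]
    refine intervalIntegral.integral_congr fun θ hθ => ?_
    rw [Set.uIcc_of_le (by linarith)] at hθ
    have : Real.sin θ ≤ 0 := by
      have := Real.sin_nonneg_of_nonneg_of_le_pi (x := θ - Real.pi) (by linarith [hθ.1])
        (by linarith [hθ.2])
      rw [Real.sin_sub_pi] at this
      linarith
    simp [abs_of_nonpos this]
  rw [h1, h2]
  ring

open Polynomial in
/-- Multiplying the lift by `z ^ (2 * m) - 1` introduces the factor `4 * sin (m * θ) ^ 2`, which is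
dominated by `4 * m * |sin θ|`. -/
theorem integral_lift_mul_le (p : ℝ[X]) {G : ℂ[X]}
    (hG : ∀ θ : ℝ, ‖G.eval (circleMap 0 1 θ)‖ ^ 2 = p.eval (Real.cos θ) ^ 2) (m : ℕ) :
    ∫ θ in (0 : ℝ)..2 * Real.pi, ‖(G * (X ^ (2 * m) - 1)).eval (circleMap 0 1 θ)‖ ^ 2
      ≤ 8 * m * ∫ x in (-1 : ℝ)..1, p.eval x ^ 2 := by
  have h := integral_comp_cos_mul_abs_sin (f := fun x => p.eval x ^ 2) (by fun_prop)
  have e : 8 * m * ∫ x in (-1 : ℝ)..1, p.eval x ^ 2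
      = ∫ θ in (0 : ℝ)..2 * Real.pi, 4 * m * (p.eval (Real.cos θ) ^ 2 * |Real.sin θ|) := by
    rw [intervalIntegral.integral_const_mul, h]; ring
  rw [e]
  have hpi := Real.pi_pos
  refine intervalIntegral.integral_mono_on (by linarith) ?_ ?_ fun θ _ => ?_
  · refine Continuous.intervalIntegrable ?_ _ _
    exact ((Polynomial.continuous _).comp (continuous_circleMap 0 1)).norm.pow 2
  · refine Continuous.intervalIntegrable ?_ _ _
    fun_prop
  · rw [eval_mul, norm_mul, mul_pow, hG, norm_eval_X_pow_sub_one]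
    have := mul_le_mul_of_nonneg_left (sin_nat_mul_sq_le m θ) (sq_nonneg (p.eval (Real.cos θ)))
    linarith

open Polynomial in
theorem eval_cos_sq_mul_sin_sq_le (p : ℝ[X]) {N : ℕ} (hp : p.natDegree ≤ N) (m : ℕ) (φ : ℝ) :
    Real.pi * (p.eval (Real.cos φ) ^ 2 * Real.sin (m * φ) ^ 2)
      ≤ (2 * N + 2 * m + 1) * m * ∫ x in (-1 : ℝ)..1, p.eval x ^ 2 := by
  obtain ⟨G, hd, hG⟩ := exists_circle_lift p hp
  have h1 : (G * (X ^ (2 * m) - 1)).natDegree ≤ 2 * N + 2 * m :=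
    natDegree_mul_le_of_le hd (by compute_degree)
  have h2 := norm_eval_sq_le_integral _ h1 φ
  rw [eval_mul, norm_mul, mul_pow, hG, norm_eval_X_pow_sub_one] at h2
  have h3 := mul_le_mul_of_nonneg_left (integral_lift_mul_le p hG m)
    (by positivity : (0 : ℝ) ≤ ((2 * N + 2 * m : ℕ) : ℝ) + 1)
  push_cast at h2 h3
  linarith

open Polynomial in
theorem eval_cos_sq_le (p : ℝ[X]) {N : ℕ} (hp : p.natDegree ≤ N) (φ : ℝ) :
    Real.pi * p.eval (Real.cos φ) ^ 2
      ≤ 4 * (2 * N + 1) * (N + 1) * ∫ x in (-1 : ℝ)..1, p.eval x ^ 2 := by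
  obtain ⟨G, hd, hG⟩ := exists_circle_lift p hp
  have h1 : (G * (X ^ (2 * (N + 1)) - 1)).natDegree ≤ 2 * N + 2 * (N + 1) :=
    natDegree_mul_le_of_le hd (by compute_degree)
  have h2 := norm_eval_sq_le_integral _ hd φ
  have h3 := integral_lift_mul_le p hG (N + 1)
  have hsum : ∑ i ∈ Finset.range (2 * N + 1), ‖G.coeff i‖ ^ 2
      ≤ ∑ i ∈ Finset.range (2 * N + 2 * (N + 1) + 1),
        ‖(G * (X ^ (2 * (N + 1)) - 1)).coeff i‖ ^ 2 := by
    refine (Finset.sum_le_sum fun i hi => ?_).trans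
      (Finset.sum_le_sum_of_subset_of_nonneg (Finset.range_subset_range.2 (by omega))
        fun i _ _ => sq_nonneg _)
    have hi' := Finset.mem_range.1 hi
    rw [mul_sub, coeff_sub, coeff_mul_X_pow', if_neg (by omega)]
    simp
  rw [integral_norm_sq_circle _ h1] at h3
  rw [integral_norm_sq_circle _ hd, hG] at h2
  have hpi := Real.pi_pos
  have h4 := mul_le_mul_of_nonneg_left ((mul_le_mul_of_nonneg_left hsum
    (by positivity : 0 ≤ 2 * Real.pi)).trans h3) (by positivity : (0 : ℝ) ≤ ((2 * N : ℕ) : ℝ) + 1)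
  push_cast at h2 h4
  linarith

open Polynomial in
theorem eval_cos_sq_mul_le (p : ℝ[X]) {N : ℕ} (hN : 1 ≤ N) (hp : p.natDegree ≤ N) {φ : ℝ}
    (h0 : 0 ≤ φ) (h1 : φ ≤ Real.pi / 2) :
    p.eval (Real.cos φ) ^ 2 * (((N : ℝ) ^ 2)⁻¹ + (N : ℝ)⁻¹ * Real.sin φ)
      ≤ 22 * ∫ x in (-1 : ℝ)..1, p.eval x ^ 2 := by
  set J := ∫ x in (-1 : ℝ)..1, p.eval x ^ 2 with hJ
  have hJ0 : 0 ≤ J := intervalIntegral.integral_nonneg (by norm_num) fun x _ => sq_nonneg _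
  set P := p.eval (Real.cos φ) ^ 2 with hP
  have hP0 : 0 ≤ P := sq_nonneg _
  have hN' : (1 : ℝ) ≤ N := by exact_mod_cast hN
  have hN0 : (0 : ℝ) < N := by linarith
  have hpi3 := Real.pi_gt_three
  have hpi4 := Real.pi_le_four
  have hA : P * ((N : ℝ) ^ 2)⁻¹ ≤ 8 * J := by
    have h := eval_cos_sq_le p hp φ
    rw [← div_eq_mul_inv, div_le_iff₀ (by positivity)]
    have h3 : 4 * (2 * (N : ℝ) + 1) * (N + 1) ≤ 24 * (N : ℝ) ^ 2 := by nlinarith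
    have h4 := mul_le_mul_of_nonneg_right h3 hJ0
    nlinarith
  have hs : Real.sin φ ≤ φ := Real.sin_le h0
  have hs0 : 0 ≤ Real.sin φ := Real.sin_nonneg_of_nonneg_of_le_pi h0 (by linarith)
  have hB : P * ((N : ℝ)⁻¹ * Real.sin φ) ≤ 14 * J := by
    rcases le_or_gt φ (N : ℝ)⁻¹ with hφ | hφ
    · have : (N : ℝ)⁻¹ * Real.sin φ ≤ ((N : ℝ) ^ 2)⁻¹ := by
        rw [sq, mul_inv]
        exact mul_le_mul_of_nonneg_left (hs.trans hφ) (by positivity)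
      have := mul_le_mul_of_nonneg_left this hP0
      linarith
    · have hφ0 : 0 < φ := lt_trans (by positivity) hφ
      set m := ⌊Real.pi / (2 * φ)⌋₊ with hm
      have hm1 : 1 ≤ m := Nat.le_floor (by
        rw [Nat.cast_one, le_div_iff₀ (by positivity)]; linarith)
      have hm1' : (1 : ℝ) ≤ m := by exact_mod_cast hm1
      have hle : (m : ℝ) * φ ≤ Real.pi / 2 := by
        have := Nat.floor_le (by positivity : 0 ≤ Real.pi / (2 * φ))
        rw [← hm, le_div_iff₀ (by positivity)] at this
        linarith
      have hge : Real.pi / 4 ≤ m * φ := by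
        have := Nat.lt_floor_add_one (Real.pi / (2 * φ))
        rw [← hm, div_lt_iff₀ (by positivity)] at this
        nlinarith
      have hsin : 1 / 2 ≤ Real.sin (m * φ) := by
        have := Real.mul_le_sin (x := m * φ) (by positivity) hle
        refine le_trans ?_ this
        rw [div_mul_eq_mul_div, le_div_iff₀ (by positivity)]
        linarith
      have hmN : (m : ℝ) ≤ 2 * N := by
        have h5 : 1 < N * φ := by
          have := mul_lt_mul_of_pos_left hφ hN0
          rwa [mul_inv_cancel₀ hN0.ne'] at this
        have h6 : (m : ℝ) * φ ≤ (2 * N) * φ := by linarith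
        exact le_of_mul_le_mul_right h6 hφ0
      have h := eval_cos_sq_mul_sin_sq_le p hp m φ
      rw [← hP, ← hJ] at h
      have h7 : P * (1 / 4) ≤ P * Real.sin (m * φ) ^ 2 :=
        mul_le_mul_of_nonneg_left (by nlinarith) hP0
      have h8 : (2 * (N : ℝ) + 2 * m + 1) * m * J ≤ 7 * N * (m * J) := by
        rw [mul_assoc]
        exact mul_le_mul_of_nonneg_right (by linarith) (by positivity)
      have h9 : Real.pi * (P * (1 / 4)) ≤ 7 * N * (m * J) :=
        (mul_le_mul_of_nonneg_left h7 Real.pi_pos.le).trans (h.trans h8)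
      have h10 : m * Real.sin φ ≤ Real.pi / 2 :=
        (mul_le_mul_of_nonneg_left hs (by positivity)).trans hle
      have h11 : Real.pi * (P * Real.sin φ) ≤ Real.pi * (14 * J * N) := by
        have a := mul_le_mul_of_nonneg_right h9 hs0
        have b := mul_le_mul_of_nonneg_left h10 (by positivity : 0 ≤ 28 * N * J)
        nlinarith
      have h12 := le_of_mul_le_mul_left h11 Real.pi_pos
      calc P * ((N : ℝ)⁻¹ * Real.sin φ) = (P * Real.sin φ) / N := by ring
        _ ≤ 14 * J := by rw [div_le_iff₀ hN0]; exact h12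
  rw [mul_add]
  linarith

open Polynomial in
/-- The lower bound for the Christoffel function of an interval. -/
theorem eval_zero_sq_mul_le (p : ℝ[X]) {N : ℕ} (hN : 1 ≤ N) (hp : p.natDegree ≤ N) {b d : ℝ}
    (hb : 0 < b) (hd0 : 0 ≤ d) (hd1 : d ≤ 1) :
    p.eval 0 ^ 2 * (b * rhoStar N d) ≤ 44 * ∫ s in (-(b * d))..b, p.eval s ^ 2 := by
  set x₀ : ℝ := (1 - d) / (1 + d) with hx₀
  have hx0 : 0 ≤ x₀ := div_nonneg (by linarith) (by linarith)
  have hx1 : x₀ ≤ 1 := by rw [hx₀, div_le_one (by linarith)]; linarith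
  set α : ℝ := -(b * (1 + d) / 2) with hα
  set β : ℝ := b * (1 - d) / 2 with hβ
  have hα0 : α ≠ 0 := by rw [hα]; exact neg_ne_zero.2 (by positivity)
  have hroot : α * x₀ + β = 0 := by rw [hα, hβ, hx₀]; field_simp; ring
  set q : ℝ[X] := p.comp (C α * X + C β) with hq
  have hqd : q.natDegree ≤ N := by
    rw [hq, natDegree_comp]
    exact (Nat.mul_le_mul_left _ (natDegree_linear_le (a := α) (b := β))).trans (by simpa using hp)
  have hqe : ∀ x, q.eval x = p.eval (α * x + β) := fun x => by simp [hq]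
  have h := eval_cos_sq_mul_le q hN hqd (Real.arccos_nonneg x₀) (Real.arccos_le_pi_div_two.2 hx0)
  rw [Real.cos_arccos (by linarith) hx1, hqe, hroot, Real.sin_arccos] at h
  simp only [hqe] at h
  rw [intervalIntegral.integral_comp_mul_add (fun s => p.eval s ^ 2) hα0] at h
  have e1 : α * -1 + β = b := by rw [hα, hβ]; ring
  have e2 : α * 1 + β = -(b * d) := by rw [hα, hβ]; ring
  rw [e1, e2, intervalIntegral.integral_symm, smul_neg, ← neg_smul, smul_eq_mul] at h
  set I := ∫ s in (-(b * d))..b, p.eval s ^ 2 with hI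
  have hI0 : 0 ≤ I := intervalIntegral.integral_nonneg (by nlinarith) fun x _ => sq_nonneg _
  have hsq : Real.sqrt d ≤ Real.sqrt (1 - x₀ ^ 2) := by
    apply Real.sqrt_le_sqrt
    have : 1 - x₀ ^ 2 = 4 * d / (1 + d) ^ 2 := by rw [hx₀]; field_simp; ring
    rw [this, le_div_iff₀ (by positivity)]
    nlinarith [mul_nonneg hd0 (sub_nonneg.2 hd1), mul_nonneg hd0 hd0]
  have hinv : -α⁻¹ ≤ 2 / b := by
    have e : -α⁻¹ = 2 / (b * (1 + d)) := by rw [hα, inv_neg, neg_neg, inv_div]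
    rw [e]
    exact div_le_div_of_nonneg_left (by norm_num) hb (by nlinarith)
  have h1 : p.eval 0 ^ 2 * rhoStar N d ≤ 22 * (2 / b * I) := by
    refine le_trans (mul_le_mul_of_nonneg_left ?_ (sq_nonneg _)) (h.trans ?_)
    · unfold rhoStar
      gcongr
    · gcongr
  calc p.eval 0 ^ 2 * (b * rhoStar N d) = b * (p.eval 0 ^ 2 * rhoStar N d) := by ring
    _ ≤ b * (22 * (2 / b * I)) := mul_le_mul_of_nonneg_left h1 hb.le
    _ = 44 * I := by field_simp; ring

theorem rhoStar_le_four_mul (n : ℕ) (d : ℝ) : rhoStar n d ≤ 4 * rhoStar (2 * n) d := by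
  unfold rhoStar
  have h : 0 ≤ (n : ℝ)⁻¹ * Real.sqrt d := by positivity
  push_cast
  rw [mul_pow, mul_inv, mul_inv]
  linarith

theorem rhoStar_nonneg (n : ℕ) (d : ℝ) : 0 ≤ rhoStar n d := by
  unfold rhoStar
  positivity

end Grain

namespace Grain

open MeasureTheory

/-- The measurable equivalence between `ℝ × ℝ` and the plane. -/
noncomputable def planeEquiv : ℝ × ℝ ≃ᵐ Plane :=
  MeasurableEquiv.finTwoArrow.symm.trans (MeasurableEquiv.toLp 2 (Fin 2 → ℝ))

theorem measurePreserving_planeEquiv : MeasurePreserving planeEquiv volume volume :=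
  ((volume_preserving_finTwoArrow ℝ).symm _).trans
    (PiLp.volume_preserving_toLp (Fin 2))

theorem planeEquiv_apply_zero (z : ℝ × ℝ) : planeEquiv z 0 = z.1 := rfl

theorem planeEquiv_apply_one (z : ℝ × ℝ) : planeEquiv z 1 = z.2 := rfl

/-- A sheared affine chart: `(t, s) ↦ x + s u + (t + K s²) v`. -/
noncomputable def chart (x u v : Plane) (K : ℝ) (z : ℝ × ℝ) : Plane :=
  x + z.2 • u + (z.1 + K * z.2 ^ 2) • v

/-- The chart in coordinates. -/
def chartCoord (x u v : Plane) (K : ℝ) (z : ℝ × ℝ) : ℝ × ℝ :=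
  (x 0 + z.2 * u 0 + (z.1 + K * z.2 ^ 2) * v 0, x 1 + z.2 * u 1 + (z.1 + K * z.2 ^ 2) * v 1)

theorem planeEquiv_chartCoord (x u v : Plane) (K : ℝ) (z : ℝ × ℝ) :
    planeEquiv (chartCoord x u v K z) = chart x u v K z := by
  ext i
  fin_cases i <;> simp [planeEquiv_apply_zero, planeEquiv_apply_one, chartCoord, chart]

theorem hasFDerivAt_chartCoord (x u v : Plane) (K : ℝ) (z : ℝ × ℝ) :
    HasFDerivAt (chartCoord x u v K)
      (Matrix.toLin (.finTwoProd ℝ) (.finTwoProd ℝ)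
        !![v 0, u 0 + 2 * K * z.2 * v 0; v 1, u 1 + 2 * K * z.2 * v 1]).toContinuousLinearMap z := by
  rw [Matrix.toLin_finTwoProd_toContinuousLinearMap]
  have h1 : HasFDerivAt (fun z : ℝ × ℝ => z.1) (ContinuousLinearMap.fst ℝ ℝ ℝ) z := hasFDerivAt_fst
  have h2 : HasFDerivAt (fun z : ℝ × ℝ => z.2) (ContinuousLinearMap.snd ℝ ℝ ℝ) z := hasFDerivAt_snd
  have hc : ∀ i, HasFDerivAt (fun z : ℝ × ℝ => x i + z.2 * u i + (z.1 + K * z.2 ^ 2) * v i)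
      (v i • ContinuousLinearMap.fst ℝ ℝ ℝ
        + (u i + 2 * K * z.2 * v i) • ContinuousLinearMap.snd ℝ ℝ ℝ) z := by
    intro i
    have := ((h2.mul_const (u i)).const_add (x i)).add
      ((h1.add ((h2.pow 2).const_mul K)).mul_const (v i))
    refine this.congr_fderiv ?_
    ext <;> simp
    ring
  exact (hc 0).prodMk (hc 1)

theorem injective_chartCoord {x u v : Plane} (hdet : v 0 * u 1 - u 0 * v 1 ≠ 0) (K : ℝ) :
    Function.Injective (chartCoord x u v K) := by
  rintro ⟨t, s⟩ ⟨t', s'⟩ h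
  simp only [chartCoord, Prod.mk.injEq] at h
  obtain ⟨h0, h1⟩ := h
  have e1 : (s - s') * (v 0 * u 1 - u 0 * v 1) = 0 := by
    linear_combination v 0 * h1 - v 1 * h0
  have hs : s = s' := sub_eq_zero.1 ((mul_eq_zero.1 e1).resolve_right hdet)
  subst hs
  have e2 : (t - t') * (v 0 * u 1 - u 0 * v 1) = 0 := by
    linear_combination u 1 * h0 - u 0 * h1
  have ht : t = t' := sub_eq_zero.1 ((mul_eq_zero.1 e2).resolve_right hdet)
  rw [ht]

/-- Change of variables along a chart. -/
theorem integral_image_chart {x u v : Plane} (hdet : v 0 * u 1 - u 0 * v 1 ≠ 0) (K : ℝ)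
    {R : Set (ℝ × ℝ)} (hR : MeasurableSet R) (F : Plane → ℝ) :
    ∫ y in chart x u v K '' R, F y
      = |v 0 * u 1 - u 0 * v 1| * ∫ z in R, F (chart x u v K z) := by
  have himg : chart x u v K '' R = planeEquiv '' (chartCoord x u v K '' R) := by
    rw [Set.image_image]
    simp only [planeEquiv_chartCoord]
  rw [himg, measurePreserving_planeEquiv.setIntegral_image_emb planeEquiv.measurableEmbedding,
    integral_image_eq_integral_abs_det_fderiv_smul volume hR
      (fun z _ => (hasFDerivAt_chartCoord x u v K z).hasFDerivWithinAt)
      (injective_chartCoord hdet K).injOn, ← integral_const_mul]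
  refine setIntegral_congr_fun hR fun z _ => ?_
  simp only [LinearMap.det_toContinuousLinearMap, LinearMap.det_toLin, Matrix.det_fin_two_of,
    smul_eq_mul, planeEquiv_chartCoord]
  congr 2
  ring

theorem continuous_chart (x u v : Plane) (K : ℝ) : Continuous (chart x u v K) := by
  unfold chart
  fun_prop

open Polynomial in
/-- Along a quadratic curve a polynomial of degree `n` restricts to one of degree `2 * n`. -/
theorem exists_polynomial_along_curve {n : ℕ} {f : MvPolynomial (Fin 2) ℝ} (hf : f ∈ Poly n)
    (a b c : Plane) :
    ∃ p : ℝ[X], p.natDegree ≤ 2 * n ∧ ∀ s, p.eval s = value f (a + s • b + s ^ 2 • c) := by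
  refine ⟨MvPolynomial.aeval (fun i => C (a i) + C (b i) * X + C (c i) * X ^ 2) f, ?_, fun s => ?_⟩
  · rw [mul_comm]
    refine MvPolynomial.aeval_natDegree_le f ((MvPolynomial.mem_restrictTotalDegree _ _ _).1 hf) _
      fun i => ?_
    compute_degree
  · rw [← Polynomial.coe_evalRingHom, MvPolynomial.aeval_def, MvPolynomial.hom_eval₂, value,
      MvPolynomial.eval, MvPolynomial.coe_eval₂Hom]
    congr 1
    · ext r
      simp
    · funext i
      simp
      ring

/-- If a quadratically sheared box at `x`, with the sides `[-b d₁, b]` and `[-b d₂, b]`, lies in `D`,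
then the integral over `D` of the square of a polynomial controls its value at `x`. -/
theorem value_sq_mul_le_of_chart_subset {D : Set Plane} (hD : IsCompact D) {n : ℕ} (hn : 1 ≤ n)
    {x u v : Plane} {K b d₁ d₂ Δ : ℝ} (hb : 0 < b) (h10 : 0 ≤ d₁) (h11 : d₁ ≤ 1) (h20 : 0 ≤ d₂)
    (h21 : d₂ ≤ 1) (hΔ : 0 < Δ) (hdet : Δ ≤ |v 0 * u 1 - u 0 * v 1|)
    (hsub : ∀ t ∈ Set.Icc (-(b * d₁)) b, ∀ s ∈ Set.Icc (-(b * d₂)) b, chart x u v K (t, s) ∈ D)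
    {f : MvPolynomial (Fin 2) ℝ} (hf : f ∈ Poly n) :
    value f x ^ 2 * (Δ * (b / 176) ^ 2 * rhoStar n d₁ * rhoStar n d₂)
      ≤ ∫ y in D, value f y ^ 2 := by
  have hN : 1 ≤ 2 * n := by omega
  have hdet0 : v 0 * u 1 - u 0 * v 1 ≠ 0 := fun h => by rw [h, abs_zero] at hdet; linarith
  set R : Set (ℝ × ℝ) := Set.Icc (-(b * d₁)) b ×ˢ Set.Icc (-(b * d₂)) b with hR
  have hRm : MeasurableSet R := measurableSet_Icc.prod measurableSet_Icc
  have hRc : IsCompact R := isCompact_Icc.prod isCompact_Icc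
  set F : ℝ × ℝ → ℝ := fun z => value f (chart x u v K z) ^ 2 with hF
  have hFc : Continuous F := ((continuous_value f).comp (continuous_chart x u v K)).pow 2
  have hint : IntegrableOn (fun y => value f y ^ 2) D :=
    ((continuous_value f).pow 2).continuousOn.integrableOn_compact hD
  have hle1 : -(b * d₁) ≤ b := by nlinarith
  have hle2 : -(b * d₂) ≤ b := by nlinarith
  have step1 : |v 0 * u 1 - u 0 * v 1| * ∫ z in R, F z ≤ ∫ y in D, value f y ^ 2 := by
    rw [← integral_image_chart hdet0 K hRm (fun y => value f y ^ 2)]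
    refine setIntegral_mono_set hint (Filter.Eventually.of_forall fun y => sq_nonneg _) ?_
    refine Filter.Eventually.of_forall ?_
    rintro y ⟨z, hz, rfl⟩
    exact hsub z.1 hz.1 z.2 hz.2
  have step2 : ∫ z in R, F z
      = ∫ t in (-(b * d₁))..b, ∫ s in (-(b * d₂))..b, F (t, s) := by
    have h := setIntegral_prod (μ := volume) (ν := volume) F (s := Set.Icc (-(b * d₁)) b)
      (t := Set.Icc (-(b * d₂)) b) (hFc.continuousOn.integrableOn_compact hRc)
    rw [intervalIntegral.integral_of_le hle1, ← integral_Icc_eq_integral_Ioc]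
    simp only [intervalIntegral.integral_of_le hle2, ← integral_Icc_eq_integral_Ioc]
    exact h
  have inner : ∀ t, F (t, 0) * (b * rhoStar (2 * n) d₂)
      ≤ 44 * ∫ s in (-(b * d₂))..b, F (t, s) := by
    intro t
    obtain ⟨p, hp, hpe⟩ := exists_polynomial_along_curve hf (x + t • v) u (K • v)
    have e : ∀ s, p.eval s ^ 2 = F (t, s) := by
      intro s
      rw [hpe, hF]
      simp only [chart]
      congr 2
      module
    have h := eval_zero_sq_mul_le p hN hp hb h20 h21
    simp only [e] at h
    exact h
  have outer : F (0, 0) * (b * rhoStar (2 * n) d₁) ≤ 44 * ∫ t in (-(b * d₁))..b, F (t, 0) := by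
    obtain ⟨p, hp, hpe⟩ := exists_polynomial_along_curve hf x v 0
    have e : ∀ t, p.eval t ^ 2 = F (t, 0) := by
      intro t
      rw [hpe, hF]
      simp only [chart]
      congr 2
      module
    have h := eval_zero_sq_mul_le p hN hp hb h10 h11
    simp only [e] at h
    exact h
  have hr1 := rhoStar_nonneg (2 * n) d₁
  have hr2 := rhoStar_nonneg (2 * n) d₂
  have hmono : (∫ t in (-(b * d₁))..b, F (t, 0)) * (b * rhoStar (2 * n) d₂)
      ≤ 44 * ∫ z in R, F z := by
    rw [step2, ← intervalIntegral.integral_mul_const, ← intervalIntegral.integral_const_mul]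
    refine intervalIntegral.integral_mono_on hle1 ?_ ?_ fun t _ => inner t
    · refine Continuous.intervalIntegrable ?_ _ _
      fun_prop
    · refine Continuous.intervalIntegrable ?_ _ _
      exact continuous_const.mul (intervalIntegral.continuous_parametric_intervalIntegral_of_continuous'
        (f := fun t s => F (t, s)) hFc _ _)
  have hF0 : F (0, 0) = value f x ^ 2 := by simp [hF, chart]
  have hV := sq_nonneg (value f x)
  have hprod : value f x ^ 2 * (b / 44) ^ 2 * rhoStar (2 * n) d₁ * rhoStar (2 * n) d₂
      ≤ ∫ z in R, F z := by
    rw [hF0] at outer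
    have a := mul_le_mul_of_nonneg_right outer (mul_nonneg hb.le hr2)
    nlinarith
  have hI0 : 0 ≤ ∫ z in R, F z := setIntegral_nonneg hRm fun z _ => sq_nonneg _
  have hrho : rhoStar n d₁ * rhoStar n d₂
      ≤ (4 * rhoStar (2 * n) d₁) * (4 * rhoStar (2 * n) d₂) :=
    mul_le_mul (rhoStar_le_four_mul n d₁) (rhoStar_le_four_mul n d₂) (rhoStar_nonneg n d₂)
      (by positivity)
  calc value f x ^ 2 * (Δ * (b / 176) ^ 2 * rhoStar n d₁ * rhoStar n d₂)
      = value f x ^ 2 * Δ * (b / 176) ^ 2 * (rhoStar n d₁ * rhoStar n d₂) := by ring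
    _ ≤ value f x ^ 2 * Δ * (b / 176) ^ 2
        * ((4 * rhoStar (2 * n) d₁) * (4 * rhoStar (2 * n) d₂)) :=
      mul_le_mul_of_nonneg_left hrho (by positivity)
    _ = Δ * (value f x ^ 2 * (b / 44) ^ 2 * rhoStar (2 * n) d₁ * rhoStar (2 * n) d₂) := by ring
    _ ≤ Δ * ∫ z in R, F z := mul_le_mul_of_nonneg_left hprod hΔ.le
    _ ≤ |v 0 * u 1 - u 0 * v 1| * ∫ z in R, F z := mul_le_mul_of_nonneg_right hdet hI0
    _ ≤ ∫ y in D, value f y ^ 2 := step1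

end Grain

namespace Grain

theorem sq_add_sq_smul_add_le {u₀ u₁ v₀ v₁ W : ℝ} (hu : u₀ ^ 2 + u₁ ^ 2 ≤ 1)
    (hv : v₀ ^ 2 + v₁ ^ 2 ≤ W) (s τ : ℝ) :
    (s * u₀ + τ * v₀) ^ 2 + (s * u₁ + τ * v₁) ^ 2 ≤ 2 * s ^ 2 + 2 * W * τ ^ 2 := by
  have h1 := mul_le_mul_of_nonneg_left hu (sq_nonneg s)
  have h2 := mul_le_mul_of_nonneg_left hv (sq_nonneg τ)
  linarith [sq_nonneg (s * u₀ - τ * v₀), sq_nonneg (s * u₁ - τ * v₁)]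

theorem abs_dot_le {a₀ a₁ v₀ v₁ W : ℝ} (ha : a₀ ^ 2 + a₁ ^ 2 ≤ 1)
    (hv : v₀ ^ 2 + v₁ ^ 2 ≤ W) (hW : 1 ≤ W) : |v₀ * a₀ + v₁ * a₁| ≤ W := by
  refine abs_le_of_sq_le_sq ?_ (by linarith)
  have h1 : (v₀ ^ 2 + v₁ ^ 2) * (a₀ ^ 2 + a₁ ^ 2) ≤ W * 1 :=
    mul_le_mul hv ha (by positivity) (by linarith)
  nlinarith [sq_nonneg (v₀ * a₁ - v₁ * a₀)]

theorem abs_shear_mul_le {W K b c₀ s t : ℝ} (hW : 1 ≤ W) (hK : 0 ≤ K) (hb0 : 0 ≤ b) (hb1 : b ≤ 1)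
    (hb : b * (1 + K) * W ≤ c₀ / 24) (hs : |s| ≤ b) (ht : |t| ≤ b) :
    |t + K * s ^ 2| * W ≤ c₀ / 24 := by
  refine le_trans (mul_le_mul_of_nonneg_right ?_ (by linarith)) hb
  refine (abs_add_le _ _).trans ?_
  have h1 : s ^ 2 ≤ b := by
    rw [← sq_abs]
    nlinarith [abs_nonneg s]
  rw [abs_of_nonneg (by positivity : 0 ≤ K * s ^ 2)]
  nlinarith [mul_le_mul_of_nonneg_left h1 hK]

/-- Moving along the sheared chart from a point `a` of the unit disc, when `v` points inwards. -/
theorem norm_sq_chart_le_of_inward {a₀ a₁ u₀ u₁ v₀ v₁ W c₀ b s t r : ℝ}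
    (ha : a₀ ^ 2 + a₁ ^ 2 ≤ 1) (hu : u₀ ^ 2 + u₁ ^ 2 ≤ 1) (hv : v₀ ^ 2 + v₁ ^ 2 ≤ W) (hW : 1 ≤ W)
    (hc : 0 < c₀) (hc1 : c₀ ≤ 1) (hb0 : 0 ≤ b) (hb1 : b ≤ 1)
    (hb : b * (1 + 2 / c₀) * W ≤ c₀ / 24) (hs : |s| ≤ b) (ht : t ≤ b) (hrt : -r ≤ t) (hr0 : 0 ≤ r)
    (hrb : r ≤ b) (hva : v₀ * a₀ + v₁ * a₁ ≤ -c₀) :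
    (a₀ + s * u₀ + (t + 2 / c₀ * s ^ 2) * v₀) ^ 2 + (a₁ + s * u₁ + (t + 2 / c₀ * s ^ 2) * v₁) ^ 2
      ≤ a₀ ^ 2 + a₁ ^ 2 + 2 * s * (u₀ * a₀ + u₁ * a₁) + 4 * W * r := by
  have hK : 0 ≤ 2 / c₀ := by positivity
  have hKc : c₀ * (2 / c₀ * s ^ 2) = 2 * s ^ 2 := by field_simp
  have h1 := abs_shear_mul_le hW hK hb0 hb1 hb hs (abs_le.2 ⟨by linarith, ht⟩)
  have hKs : 0 ≤ 2 / c₀ * s ^ 2 := by positivity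
  set κ := 2 / c₀ * s ^ 2 with hκ
  set τ := t + κ with hτ
  have h2 := sq_add_sq_smul_add_le hu hv s τ
  have h3 : 2 * W * τ ^ 2 ≤ c₀ * |τ| := by
    rw [← sq_abs]
    nlinarith [abs_nonneg τ, mul_le_mul_of_nonneg_left h1 (abs_nonneg τ)]
  have h4 := abs_le.1 (abs_dot_le ha hv hW)
  have key : 2 * τ * (v₀ * a₀ + v₁ * a₁) + c₀ * |τ| + 2 * s ^ 2 ≤ 4 * W * r := by
    rcases le_or_gt 0 τ with h | h
    · rw [abs_of_nonneg h]
      have := mul_le_mul_of_nonneg_left hva h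
      nlinarith
    · rw [abs_of_neg h]
      have h5 : -τ ≤ r := by linarith
      have h6 : κ ≤ r := by linarith
      have h7 := mul_le_mul_of_nonneg_left h4.1 (by linarith : 0 ≤ -τ)
      have h8 := mul_le_mul_of_nonneg_right h5 (by linarith : 0 ≤ W)
      nlinarith
  linarith

/-- Moving along the sheared chart from a point well inside the unit disc. -/
theorem norm_sq_chart_le_of_interior {a₀ a₁ u₀ u₁ v₀ v₁ W c₀ b s t : ℝ}
    (hc : 0 < c₀) (hc1 : c₀ ≤ 1 / 4) (ha : a₀ ^ 2 + a₁ ^ 2 ≤ 1 - c₀) (hu : u₀ ^ 2 + u₁ ^ 2 ≤ 1)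
    (hv : v₀ ^ 2 + v₁ ^ 2 ≤ W) (hW : 1 ≤ W) (hb0 : 0 ≤ b) (hb1 : b ≤ 1)
    (hb : b * (1 + 2 / c₀) * W ≤ c₀ / 24) (hs : |s| ≤ b) (ht : |t| ≤ b) :
    (a₀ + s * u₀ + (t + 2 / c₀ * s ^ 2) * v₀) ^ 2 + (a₁ + s * u₁ + (t + 2 / c₀ * s ^ 2) * v₁) ^ 2
      ≤ 1 := by
  have hK : 0 ≤ 2 / c₀ := by positivity
  have hbc : b ≤ c₀ / 24 := by
    have h1 : 1 ≤ (1 + 2 / c₀) * W := by nlinarith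
    nlinarith
  have h1 := abs_shear_mul_le hW hK hb0 hb1 hb hs ht
  set τ := t + 2 / c₀ * s ^ 2 with hτ
  have h2 := sq_add_sq_smul_add_le hu hv s τ
  have ha1 : a₀ ^ 2 + a₁ ^ 2 ≤ 1 := by linarith
  have h4 := abs_dot_le ha1 hv hW
  have h5 := abs_dot_le ha1 hu le_rfl
  have h6 : 2 * τ * (v₀ * a₀ + v₁ * a₁) ≤ 2 * (|τ| * W) := by
    refine (le_abs_self _).trans ?_
    rw [abs_mul, abs_mul, abs_two]
    nlinarith [mul_le_mul_of_nonneg_left h4 (abs_nonneg τ)]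
  have h7 : 2 * s * (u₀ * a₀ + u₁ * a₁) ≤ 2 * b := by
    refine (le_abs_self _).trans ?_
    rw [abs_mul, abs_mul, abs_two]
    nlinarith [mul_le_mul_of_nonneg_left h5 (abs_nonneg s)]
  have h8 : s ^ 2 ≤ b := by
    rw [← sq_abs]
    nlinarith [abs_nonneg s]
  have h9 : W * τ ^ 2 ≤ |τ| * W := by
    have : |τ| ≤ 1 := by nlinarith [abs_nonneg τ]
    rw [← sq_abs]
    nlinarith [mul_nonneg (abs_nonneg τ) (by linarith : 0 ≤ W)]
  linarith

theorem disc₂_eq (h : ℝ) : disc₂ h = Metric.closedBall (shift h) 1 := by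
  unfold disc₂ disc₁
  rw [Set.image_add_right]
  ext y
  simp [dist_eq_norm, sub_eq_add_neg]

theorem norm_sq_coord (y : Plane) : ‖y‖ ^ 2 = y 0 ^ 2 + y 1 ^ 2 := by
  rw [EuclideanSpace.norm_sq_eq]
  simp

theorem norm_sub_shift_sq (h : ℝ) (y : Plane) :
    ‖y - shift h‖ ^ 2 = y 0 ^ 2 + (y 1 - h) ^ 2 := by
  rw [norm_sq_coord]
  simp [shift]

theorem mem_grain_iff_norm {h : ℝ} {y : Plane} : y ∈ grain h ↔ ‖y‖ ≤ 1 ∧ ‖y - shift h‖ ≤ 1 := by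
  rw [grain, disc₂_eq, disc₁]
  simp [dist_eq_norm]

theorem mem_grain_iff {h : ℝ} {y : Plane} :
    y ∈ grain h ↔ y 0 ^ 2 + y 1 ^ 2 ≤ 1 ∧ y 0 ^ 2 + (y 1 - h) ^ 2 ≤ 1 := by
  rw [mem_grain_iff_norm, ← norm_sq_coord, ← norm_sub_shift_sq,
    sq_le_one_iff₀ (norm_nonneg _), sq_le_one_iff₀ (norm_nonneg _)]

theorem isCompact_grain (h : ℝ) : IsCompact (grain h) := by
  rw [grain, disc₂_eq, disc₁]
  exact (isCompact_closedBall _ _).inter (isCompact_closedBall _ _)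

theorem interior_grain_nonempty {h : ℝ} (h0 : 0 < h) (h2 : h < 2) :
    (interior (grain h)).Nonempty := by
  refine ⟨!₂[0, h / 2], interior_mono (s := Metric.ball 0 1 ∩ Metric.ball (shift h) 1) ?_ ?_⟩
  · rw [grain, disc₂_eq, disc₁]
    exact Set.inter_subset_inter Metric.ball_subset_closedBall Metric.ball_subset_closedBall
  · rw [(Metric.isOpen_ball.inter Metric.isOpen_ball).interior_eq]
    have e1 : ‖(!₂[0, h / 2] : Plane)‖ ^ 2 < 1 := by
      rw [norm_sq_coord]; simp only [Matrix.cons_val_zero, Matrix.cons_val_one]; nlinarith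
    have e2 : ‖(!₂[0, h / 2] : Plane) - shift h‖ ^ 2 < 1 := by
      rw [norm_sub_shift_sq]; simp only [Matrix.cons_val_zero, Matrix.cons_val_one]; nlinarith
    rw [sq_lt_one_iff₀ (norm_nonneg _)] at e1 e2
    exact ⟨by simpa [dist_eq_norm] using e1, by simpa [dist_eq_norm] using e2⟩

theorem dStar₁_mem {h : ℝ} {x : Plane} (hx : x ∈ grain h) : 0 ≤ dStar₁ x ∧ dStar₁ x ≤ 1 := by
  have := (mem_grain_iff_norm.1 hx).1
  unfold dStar₁
  constructor <;> linarith [norm_nonneg x]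

theorem dStar₂_mem {h : ℝ} {x : Plane} (hx : x ∈ grain h) : 0 ≤ dStar₂ h x ∧ dStar₂ h x ≤ 1 := by
  have := (mem_grain_iff_norm.1 hx).2
  unfold dStar₂
  constructor <;> linarith [norm_nonneg (x - shift h)]

theorem exists_chart_subset_at {h g β W b c₀ : ℝ} (h0 : 0 < h) (hg : g = 1 - h ^ 2 / 4)
    (hg0 : 0 < g) (hc₀ : c₀ = g / 4) (hc1 : c₀ ≤ 1 / 4) (hβ : β = h / 2 - g / (2 * h))
    (hWdef : W = 2 + 2 * β ^ 2) (hW : 1 ≤ W) (hb0 : 0 < b) (hb1 : b ≤ 1 / 96)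
    (hb : b * (1 + 2 / c₀) * W ≤ c₀ / 24) (hbW : b * W ≤ c₀ / 24) {x : Plane} (hx : x ∈ grain h)
    (hle : dStar₁ x ≤ dStar₂ h x) :
    ∃ u v : Plane, c₀ ≤ |v 0 * u 1 - u 0 * v 1| ∧
      ∀ t ∈ Set.Icc (-(b * dStar₁ x)) b, ∀ s ∈ Set.Icc (-(b * dStar₂ h x)) b,
        chart x u v (2 / c₀) (t, s) ∈ grain h := by
  have hc0 : 0 < c₀ := by rw [hc₀]; positivity
  have hhβ : h * β = h ^ 2 / 2 - g / 2 := by rw [hβ]; field_simp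
  obtain ⟨hx1, hx2⟩ := mem_grain_iff.1 hx
  obtain ⟨hd10, hd11⟩ := dStar₁_mem hx
  obtain ⟨hd20, hd21⟩ := dStar₂_mem hx
  have hD1 : x 0 ^ 2 + x 1 ^ 2 ≤ 1 - dStar₁ x := by
    rw [← norm_sq_coord]
    have h3 := mul_le_of_le_one_right (norm_nonneg x) (mem_grain_iff_norm.1 hx).1
    unfold dStar₁
    linarith
  have hD2 : x 0 ^ 2 + (x 1 - h) ^ 2 ≤ 1 - dStar₂ h x := by
    rw [← norm_sub_shift_sq]
    have h3 := mul_le_of_le_one_right (norm_nonneg (x - shift h)) (mem_grain_iff_norm.1 hx).2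
    unfold dStar₂
    linarith
  have hx1h : h / 2 ≤ x 1 := by
    have h3 : ‖x - shift h‖ ≤ ‖x‖ := by unfold dStar₁ dStar₂ at hle; linarith
    have h4 := pow_le_pow_left₀ (norm_nonneg _) h3 2
    rw [norm_sub_shift_sq, norm_sq_coord] at h4
    exact le_of_mul_le_mul_left (by linarith : h * (h / 2) ≤ h * x 1) h0
  generalize dStar₁ x = d₁ at *
  generalize dStar₂ h x = d₂ at *
  obtain ⟨σ, hσa, hσx⟩ : ∃ σ : ℝ, |σ| = 1 ∧ 0 ≤ σ * x 0 := by
    rcases le_total 0 (x 0) with h3 | h3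
    · exact ⟨1, by norm_num, by linarith⟩
    · exact ⟨-1, by norm_num, by linarith⟩
  obtain ⟨u, hu0, hu1⟩ : ∃ u : Plane, u 0 = -(σ * x 1) ∧ u 1 = σ * x 0 :=
    ⟨!₂[-(σ * x 1), σ * x 0], rfl, rfl⟩
  obtain ⟨v, hv0, hv1⟩ : ∃ v : Plane, v 0 = -x 0 ∧ v 1 = β - x 1 :=
    ⟨!₂[-x 0, β - x 1], rfl, rfl⟩
  have hun : u 0 ^ 2 + u 1 ^ 2 ≤ 1 := by
    have : u 0 ^ 2 + u 1 ^ 2 = σ ^ 2 * (x 0 ^ 2 + x 1 ^ 2) := by rw [hu0, hu1]; ring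
    rw [this, ← sq_abs σ, hσa]
    linarith
  have hvn : v 0 ^ 2 + v 1 ^ 2 ≤ W := by
    have e : (β - x 1) ^ 2 = 2 * β ^ 2 + 2 * x 1 ^ 2 - (β + x 1) ^ 2 := by ring
    rw [hv0, hv1, hWdef, neg_sq, e]
    linarith [sq_nonneg (β + x 1), sq_nonneg (x 0)]
  have hvx : v 0 * x 0 + v 1 * x 1 ≤ -c₀ := by
    have e : g / (2 * h) * h = g / 2 := by field_simp
    have h5 : g / (2 * h) ≤ x 1 - β := by rw [hβ]; linarith
    have hgh : 0 ≤ g / (2 * h) := by positivity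
    have h6 : g / (2 * h) * (h / 2) ≤ (x 1 - β) * x 1 :=
      mul_le_mul h5 hx1h (by positivity) (by linarith)
    rw [hv0, hv1]
    linarith [sq_nonneg (x 0)]
  refine ⟨u, v, ?_, ?_⟩
  · have e : v 0 * u 1 - u 0 * v 1 = σ * (v 0 * x 0 + v 1 * x 1) := by rw [hu0, hu1]; ring
    rw [e, abs_mul, hσa, one_mul]
    exact le_trans (by linarith) (neg_le_abs _)
  · rintro t ⟨ht1, ht2⟩ s ⟨hs1, hs2⟩
    have hbd1 : b * d₁ ≤ b := mul_le_of_le_one_right hb0.le hd11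
    have hbd2 : b * d₂ ≤ b := mul_le_of_le_one_right hb0.le hd21
    have hbd10 : 0 ≤ b * d₁ := by positivity
    have hbd20 : 0 ≤ b * d₂ := by positivity
    have hs : |s| ≤ b := abs_le.2 ⟨by linarith, hs2⟩
    have ht : |t| ≤ b := abs_le.2 ⟨by linarith, ht2⟩
    have hbWd : 4 * W * (b * d₁) ≤ d₁ / 2 := by
      have h3 := mul_le_mul_of_nonneg_right hbW hd10
      have h4 := mul_le_mul_of_nonneg_right hc1 hd10
      linarith
    have c0 : chart x u v (2 / c₀) (t, s) 0 = x 0 + s * u 0 + (t + 2 / c₀ * s ^ 2) * v 0 := rfl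
    have c1 : chart x u v (2 / c₀) (t, s) 1 = x 1 + s * u 1 + (t + 2 / c₀ * s ^ 2) * v 1 := rfl
    have c2 : chart x u v (2 / c₀) (t, s) 1 - h
        = (x 1 - h) + s * u 1 + (t + 2 / c₀ * s ^ 2) * v 1 := by rw [c1]; ring
    rw [mem_grain_iff, c2, c0, c1]
    constructor
    · have h7 := norm_sq_chart_le_of_inward hx1 hun hvn hW hc0 (by linarith) hb0.le (by linarith)
        hb hs ht2 ht1 hbd10 hbd1 hvx
      have h8 : u 0 * x 0 + u 1 * x 1 = 0 := by rw [hu0, hu1]; ring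
      rw [h8] at h7
      linarith
    · rcases le_or_gt (x 0 ^ 2 + (x 1 - h) ^ 2) (1 - c₀) with h9 | h9
      · exact norm_sq_chart_le_of_interior hc0 hc1 h9 hun hvn hW hb0.le (by linarith) hb hs ht
      · have hva : v 0 * x 0 + v 1 * (x 1 - h) ≤ -c₀ := by
          have e : v 0 * x 0 + v 1 * (x 1 - h)
              = -(x 0 ^ 2 + (x 1 - h) ^ 2) + (h - β) * (h - x 1) := by rw [hv0, hv1]; ring
          have hhb : 0 ≤ h - β := by
            have : 0 ≤ g / (2 * h) := by positivity
            rw [hβ]; linarith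
          have h10 : (h - β) * (h - x 1) ≤ (h - β) * (h / 2) :=
            mul_le_mul_of_nonneg_left (by linarith) hhb
          rw [e]
          linarith
        have h7 := norm_sq_chart_le_of_inward hx2 hun hvn hW hc0 (by linarith) hb0.le
          (by linarith) hb hs ht2 ht1 hbd10 hbd1 hva
        have h8 : u 0 * x 0 + u 1 * (x 1 - h) = -(σ * x 0 * h) := by rw [hu0, hu1]; ring
        have h11 := abs_le.1 (abs_dot_le hx2 hun le_rfl)
        rw [h8] at h7 h11
        have h12 : 2 * s * -(σ * x 0 * h) ≤ 2 * (b * d₂) := by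
          have h13 : 0 ≤ σ * x 0 * h := by positivity
          have h14 := mul_le_mul_of_nonneg_right (neg_le.1 hs1) h13
          have h15 := mul_le_mul_of_nonneg_left (neg_le_neg_iff.1 h11.1) hbd20
          linarith
        have h16 := mul_le_mul_of_nonneg_right hb1 hd20
        linarith

theorem exists_chart_subset_of_le {h : ℝ} (h0 : 0 < h) (h2 : h < 2) :
    ∃ b K Δ : ℝ, 0 < b ∧ 0 < Δ ∧ ∀ x ∈ grain h, dStar₁ x ≤ dStar₂ h x →
      ∃ u v : Plane, Δ ≤ |v 0 * u 1 - u 0 * v 1| ∧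
        ∀ t ∈ Set.Icc (-(b * dStar₁ x)) b, ∀ s ∈ Set.Icc (-(b * dStar₂ h x)) b,
          chart x u v K (t, s) ∈ grain h := by
  set g : ℝ := 1 - h ^ 2 / 4 with hg
  have hg0 : 0 < g := by rw [hg]; nlinarith
  have hg1 : g ≤ 1 := by rw [hg]; nlinarith
  set c₀ : ℝ := g / 4 with hc₀
  have hc0 : 0 < c₀ := by positivity
  have hc1 : c₀ ≤ 1 / 4 := by rw [hc₀]; linarith
  set β : ℝ := h / 2 - g / (2 * h) with hβ
  set W : ℝ := 2 + 2 * β ^ 2 with hWdef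
  have hW : 1 ≤ W := by nlinarith [sq_nonneg β]
  have hW0 : 0 < W := by linarith
  set b : ℝ := c₀ / 24 / ((1 + 2 / c₀) * W) with hbdef
  have hden : 1 ≤ (1 + 2 / c₀) * W := by
    have : 0 ≤ 2 / c₀ := by positivity
    nlinarith
  have hb0 : 0 < b := by positivity
  have hb : b * (1 + 2 / c₀) * W ≤ c₀ / 24 := by
    rw [mul_assoc, hbdef, div_mul_cancel₀ _ (by positivity)]
  have hbW : b * W ≤ c₀ / 24 := by
    refine le_trans ?_ hb
    have : 0 ≤ 2 / c₀ := by positivity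
    have := mul_nonneg (mul_nonneg hb0.le this) hW0.le
    linarith
  have hb1 : b ≤ 1 / 96 := by linarith [le_mul_of_one_le_right hb0.le hW]
  exact ⟨b, 2 / c₀, c₀, hb0, hc0, fun x hx hle =>
    exists_chart_subset_at h0 hg hg0 hc₀ hc1 hβ hWdef hW hb0 hb1 hb hbW hx hle⟩

theorem dStar₁_shift_sub (h : ℝ) (x : Plane) : dStar₁ (shift h - x) = dStar₂ h x := by
  rw [dStar₁, dStar₂, norm_sub_rev]

theorem dStar₂_shift_sub (h : ℝ) (x : Plane) : dStar₂ h (shift h - x) = dStar₁ x := by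
  rw [dStar₁, dStar₂]
  simp

theorem shift_sub_mem_grain {h : ℝ} {x : Plane} (hx : x ∈ grain h) : shift h - x ∈ grain h := by
  rw [mem_grain_iff_norm] at hx ⊢
  refine ⟨by rw [norm_sub_rev]; exact hx.2, by simpa using hx.1⟩

/-- The square of the value at `x` is controlled by the integral over the grain. -/
theorem exists_value_sq_mul_le {h : ℝ} (h0 : 0 < h) (h2 : h < 2) :
    ∃ c : ℝ, 0 < c ∧ ∀ n : ℕ, 1 ≤ n → ∀ x ∈ grain h, ∀ f ∈ Poly n,
      value f x ^ 2 * (c * rhoStar n (dStar₁ x) * rhoStar n (dStar₂ h x))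
        ≤ ∫ y in grain h, value f y ^ 2 := by
  obtain ⟨b, K, Δ, hb, hΔ, H⟩ := exists_chart_subset_of_le h0 h2
  refine ⟨Δ * (b / 176) ^ 2, by positivity, fun n hn x hx f hf => ?_⟩
  obtain ⟨h10, h11⟩ := dStar₁_mem hx
  obtain ⟨h20, h21⟩ := dStar₂_mem hx
  rcases le_total (dStar₁ x) (dStar₂ h x) with hle | hle
  · obtain ⟨u, v, hdet, hsub⟩ := H x hx hle
    exact value_sq_mul_le_of_chart_subset (isCompact_grain h) hn hb h10 h11 h20 h21 hΔ hdet hsub hf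
  · obtain ⟨u, v, hdet, hsub⟩ := H (shift h - x) (shift_sub_mem_grain hx)
      (by rw [dStar₁_shift_sub, dStar₂_shift_sub]; exact hle)
    rw [dStar₁_shift_sub, dStar₂_shift_sub] at hsub
    have hdet' : Δ ≤ |(-v) 0 * (-u) 1 - (-u) 0 * (-v) 1| := by simpa using hdet
    have hsub' : ∀ t ∈ Set.Icc (-(b * dStar₂ h x)) b, ∀ s ∈ Set.Icc (-(b * dStar₁ x)) b,
        chart x (-u) (-v) K (t, s) ∈ grain h := by
      intro t ht s hs
      have := shift_sub_mem_grain (hsub t ht s hs)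
      convert this using 1
      simp only [chart]
      module
    have := value_sq_mul_le_of_chart_subset (isCompact_grain h) hn hb h20 h21 h10 h11 hΔ hdet'
      hsub' hf
    rwa [mul_right_comm] at this

theorem infDist_sphere_of_mem_closedBall {c x : Plane} (hx : ‖x - c‖ ≤ 1) :
    Metric.infDist x (Metric.sphere c 1) = 1 - ‖x - c‖ := by
  obtain ⟨w, hw, hxw⟩ : ∃ w : Plane, ‖w‖ = 1 ∧ x - c = ‖x - c‖ • w := by
    rcases eq_or_ne (x - c) 0 with h | h
    · exact ⟨!₂[1, 0], by rw [EuclideanSpace.norm_eq]; simp, by simp [h]⟩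
    · have hn : ‖x - c‖ ≠ 0 := norm_ne_zero_iff.2 h
      exact ⟨‖x - c‖⁻¹ • (x - c), by rw [norm_smul, norm_inv, norm_norm, inv_mul_cancel₀ hn],
        by rw [smul_smul, mul_inv_cancel₀ hn, one_smul]⟩
  have hmem : c + w ∈ Metric.sphere c 1 := by simp [hw]
  refine le_antisymm ?_ ?_
  · refine (Metric.infDist_le_dist_of_mem hmem).trans ?_
    have e : x - (c + w) = (‖x - c‖ - 1) • w := by
      rw [sub_smul, ← hxw, one_smul]; abel
    rw [dist_eq_norm, e, norm_smul, hw, mul_one, Real.norm_eq_abs, abs_of_nonpos (by linarith)]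
    linarith
  · refine (Metric.le_infDist ⟨_, hmem⟩).2 fun y hy => ?_
    have hy' : ‖y - c‖ = 1 := by simpa [dist_eq_norm] using hy
    have := norm_sub_norm_le (y - c) (x - c)
    rw [sub_sub_sub_cancel_right, hy'] at this
    rw [dist_comm, dist_eq_norm]
    exact this

end Grain

theorem mainTheorem2 (h : ℝ) (h0 : 0 < h) (h2 : h < 2) :
    (∀ x ∈ Grain.grain h,
      Grain.dStar₁ x = Metric.infDist x (frontier Grain.disc₁) ∧
      Grain.dStar₂ h x = Metric.infDist x (frontier (Grain.disc₂ h))) ∧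
    ∃ c : ℝ, 0 < c ∧ ∀ n : ℕ, 1 ≤ n → ∀ x ∈ Grain.grain h,
      c * Grain.rhoStar n (Grain.dStar₁ x) * Grain.rhoStar n (Grain.dStar₂ h x)
        ≤ Grain.christoffel n (Grain.grain h) x := by
  refine ⟨fun x hx => ?_, ?_⟩
  · obtain ⟨hx1, hx2⟩ := Grain.mem_grain_iff_norm.1 hx
    constructor
    · rw [Grain.disc₁, frontier_closedBall _ one_ne_zero,
        Grain.infDist_sphere_of_mem_closedBall (by simpa using hx1), sub_zero, Grain.dStar₁]
    · rw [Grain.disc₂_eq, frontier_closedBall _ one_ne_zero,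
        Grain.infDist_sphere_of_mem_closedBall hx2, Grain.dStar₂]
  · obtain ⟨c, hc, H⟩ := Grain.exists_value_sq_mul_le h0 h2
    refine ⟨c, hc, fun n hn x hx => ?_⟩
    obtain ⟨p, hp⟩ := Grain.exists_isOrthonormalBasis n (Grain.isCompact_grain h)
      (Grain.interior_grain_nonempty h0 h2)
    rw [Grain.christoffel_eq (Grain.isCompact_grain h) hp x]
    obtain ⟨f, hf, hfx, he⟩ :=
      (Grain.isLeast_of_isOrthonormalBasis (Grain.isCompact_grain h) hp x).1
    rw [he]
    have := H n hn x hx f hf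
    rwa [hfx, one_pow, one_mul] at this
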